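/- Let $L$ be a relational language and let $<$ be a binary relation symbol not in $L$. Let $\mathcal S=(S,L^S,<^S)$ be an $(L\cup\{<\})$-structure such that $<^S$ is a linear order on $S$ of order type $\omega$, and such that $\mathcal F=(S,L^S)$ is a Fraïssé limit of a Fraïssé class $\mathbf K$ of finite $L$-structures (so $\mathcal F$ is countably infinite and ultrahomogeneous, and $\mathbf K$ is its age). For a structure $\mathcal M$ let $\mathrm{Fin}(\mathcal M)$ be the set of its nonempty finite substructures, and for structures $\mathcal A,\mathcal B$ let $\binom{\mathcal B}{\mathcal A}$ be the set of all substructures of $\mathcal B$ that are isomorphic to $\mathcal A$. Assume the following. * (Big Ramsey degrees) For every nonempty $\mathcal A\in\mathbf K$ there is a positive integer $t$ such that for every $k\ge 2$ and every coloring $\chi:\mathrm{Emb}(\mathcal A,\mathcal F)\to k$ there is an embedding $w:\mathcal F\hookrightarrow\mathcal F$ with $|\chi(w\circ\mathrm{Emb}(\mathcal A,\mathcal F))|\le t$. * (Strong amalgamation) For all nonempty $\mathcal A,\mathcal B,\mathcal C\in\mathbf K$ and all embeddings $f:\mathcal A\hookrightarrow\mathcal B$, $g:\mathcal A\hookrightarrow\mathcal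 C$ there are $\mathcal D\in\mathbf K$ and embeddings $f':\mathcal B\hookrightarrow\mathcal D$, $g':\mathcal C\hookrightarrow\mathcal D$ with $f'\circ f=g'\circ g$ and $f'(\mathcal B)\cap g'(\mathcal C)=f'(f(\mathcal A))$. * (Natural 1-point extensions) There is a functor $J:\mathrm{Fin}(\mathcal F)\to\mathrm{Fin}(\mathcal F)$, where $\mathrm{Fin}(\mathcal F)$ is regarded as a category with all embeddings as morphisms, such that for every $\mathcal A\in\mathrm{Fin}(\mathcal F)$ the structure $J(\mathcal A)$ contains $\mathcal A$ and has exactly one further point, and such that for every embedding $f:\mathcal A\hookrightarrow\mathcal B$ in $\mathrm{Fin}(\mathcal F)$ the embedding $J(f)$ extends $f$ and maps the new point of $J(\mathcal A)$ to the new point of $J(\mathcal B)$. Then for every $\mathcal A\in\mathrm{Fin}(\mathcal S)$ there is an $n\in\mathbb N$ such that for every $k\in\mathbb N$ and every family of colorings $\gamma_{\mathcal B}:\binom{\mathcal B}{\mathcal A}\to k=\{0,\dots,k-1\}$, indexed by $\mathcal B\in\mathrm{Fin}(\mathcal S)$, there are a substructure $\mathcal S'$ of $\mathcal S$ isomorphic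 to $\mathcal S$ and a choice function $c:\binom{\mathcal S'}{\mathcal A}\to\mathrm{Fin}(\mathcal S)$, with $\mathcal E\le c(\mathcal E)$ for all $\mathcal E$, such that $$\Big|\Big\{\gamma_{c(\mathcal E)}(\mathcal E):\mathcal E\in\tbinom{\mathcal S'}{\mathcal A}\Big\}\Big|\le n.$$ -/

import Mathlib

universe u v w

namespace LooseColorings

open CategoryTheory
open scoped FirstOrder

/-! ### Finite substructures and copies -/

/-- `Fin(M)`: the nonempty finite substructures of `M`. -/
structure FinSub (L : FirstOrder.Language.{u, v}) (M : Type w) [L.Structure M] where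
  /-- the underlying substructure -/
  carrier : L.Substructure M
  finite : (carrier : Set M).Finite
  nonempty : (carrier : Set M).Nonempty

/-- `Fin(M)` as a category: the morphisms are all the embeddings. -/
instance FinSub.category (L : FirstOrder.Language.{u, v}) (M : Type w) [L.Structure M] :
    Category (FinSub L M) where
  Hom A B := A.carrier ↪[L] B.carrier
  id A := FirstOrder.Language.Embedding.refl L A.carrier
  comp f g := FirstOrder.Language.Embedding.comp g f

/-- `binom B A`: the substructures of `B` (as substructures of an ambient structure `M`)
that are isomorphic to `A`. -/
def copies {L : FirstOrder.Language.{u, v}} {M : Type w} [L.Structure M]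
    (B : L.Substructure M) (A : Type w) [L.Structure A] : Set (L.Substructure M) :=
  {E | E ≤ B ∧ Nonempty (E ≃[L] A)}

/-! ### Natural one-point extensions -/

/-- There is a functor `J` from `Fin(M)` to itself such that `J(A)` is a one-point extension of `A`,
and, for every embedding `f` of `A` into `B`, the embedding `J(f)` extends `f` and maps the new
point of `J(A)` to the new point of `J(B)`. -/
def HasNaturalOnePointExtensions (L : FirstOrder.Language.{u, v}) (M : Type w) [L.Structure M] : Prop :=
  ∃ J : FinSub L M ⥤ FinSub L M,
    (∀ A : FinSub L M, A.carrier ≤ (J.obj A).carrier ∧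
      (((J.obj A).carrier : Set M) \ (A.carrier : Set M)).ncard = 1) ∧
    ∀ (A B : FinSub L M) (f : A.carrier ↪[L] B.carrier)
      (Jf : (J.obj A).carrier ↪[L] (J.obj B).carrier), Jf = J.map (X := A) (Y := B) f →
      (∀ (a : M) (ha : a ∈ A.carrier) (ha' : a ∈ (J.obj A).carrier),
        (Jf ⟨a, ha'⟩ : M) = f ⟨a, ha⟩) ∧
      (fun x : (J.obj A).carrier => (Jf x : M)) '' {x | (x : M) ∉ A.carrier} =
        ((J.obj B).carrier : Set M) \ (B.carrier : Set M)

/-! ### Strong amalgamation -/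

/-- The strong amalgamation property of a class `K` of structures (empty structures are not
amalgamated over). -/
def StrongAmalgamation {L : FirstOrder.Language.{u, v}} (K : Set (Bundled.{w} L.Structure)) : Prop :=
  ∀ (A B C : Bundled.{w} L.Structure) (f : A ↪[L] B) (g : A ↪[L] C),
    Nonempty A → A ∈ K → B ∈ K → C ∈ K →
      ∃ (D : Bundled.{w} L.Structure) (f' : B ↪[L] D) (g' : C ↪[L] D),
        D ∈ K ∧ f'.comp f = g'.comp g ∧
          Set.range f' ∩ Set.range g' = Set.range (f'.comp f)

/-! ### Big Ramsey degrees -/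

/-- The arrow relation: every `k`-coloring of the embeddings of `A` into `M` takes at most `n`
values on the composites of some self-embedding `h` of `M` with the embeddings of `A` into `M`. -/
def BigArrow (L : FirstOrder.Language.{u, v}) (A M : Type w) [L.Structure A] [L.Structure M]
    (k n : ℕ) : Prop :=
  ∀ χ : (A ↪[L] M) → Fin k, ∃ h : M ↪[L] M,
    (Set.range fun f : A ↪[L] M => χ (h.comp f)).encard ≤ n

/-- The big (embedding) Ramsey degree `T(A, M)`: the least positive integer `n` that works for
all `k ≥ 2`, and `⊤` if there is none. -/
noncomputable def bigRamseyDegree (L : FirstOrder.Language.{u, v}) (A M : Type w)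
    [L.Structure A] [L.Structure M] : ℕ∞ :=
  ⨅ n ∈ {n : ℕ | 0 < n ∧ ∀ k : ℕ, 2 ≤ k → BigArrow L A M k n}, (n : ℕ∞)

/-! ### Enumerated structures -/

/-- The relation symbols of the language with one binary symbol. -/
inductive LtRel : ℕ → Type
  | lt : LtRel 2

/-- The relational language whose only symbol is the binary symbol `<`. -/
def ltLang : FirstOrder.Language.{0, 0} := ⟨fun _ => Empty, LtRel⟩

/-- The symbol `<`. -/
def ltSymb : ltLang.Relations 2 := LtRel.lt

/-- The relation interpreting `<` in `M`. -/
def ltOn (M : Type w) [ltLang.Structure M] (x y : M) : Prop :=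
  FirstOrder.Language.Structure.RelMap ltSymb ![x, y]

/-- `<` is a linear order of order type `ω` on `M`. -/
def HasOrderTypeOmega (M : Type w) [ltLang.Structure M] : Prop :=
  Nonempty (ltOn M ≃r ((· < ·) : ℕ → ℕ → Prop))

/-- The language `L ∪ {<}`, where `<` is not a symbol of `L` (disjoint union). -/
abbrev withLt (L : FirstOrder.Language.{u, v}) : FirstOrder.Language.{u, v} := L.sum ltLang

end LooseColorings

namespace LooseColorings

open FirstOrder.Language
open scoped FirstOrder

variable {L : FirstOrder.Language.{u, v}} {S : Type w} [L.Structure S]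

/-- In a relational language every subset of a structure carries a substructure. -/
def setSubstructure [L.IsRelational] (s : Set S) : L.Substructure S where
  carrier := s
  fun_mem f := isEmptyElim f

theorem setSubstructure_mem_age [L.IsRelational] {s : Set S} (hs : s.Finite) :
    CategoryTheory.Bundled.of (c := L.Structure) (setSubstructure (L := L) s) ∈ L.age S := by
  refine ⟨?_, ⟨Substructure.subtype _⟩⟩
  have : Finite (setSubstructure (L := L) s) := hs.to_subtype
  exact Structure.fg_iff_finite.2 this

/-- A strong form of the extension property of ultrahomogeneous structures: if the age has strong
amalgamation, then embeddings of finite substructures extend to a further point whose image avoids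
a given finite set. -/
theorem exists_extension_notMem [L.IsRelational] (hS : L.IsUltrahomogeneous S)
    (hsap : StrongAmalgamation (L.age S)) {X : Set S} (hX : X.Finite) (hne : X.Nonempty)
    (g : setSubstructure (L := L) X ↪[L] S) {s : S} (hs : s ∉ X) {Y : Set S} (hY : Y.Finite) :
    ∃ g' : setSubstructure (L := L) (insert s X) ↪[L] S,
      (∀ x (hx : x ∈ X), g' ⟨x, Set.mem_insert_of_mem s hx⟩ = g ⟨x, hx⟩) ∧
        g' ⟨s, Set.mem_insert s X⟩ ∉ Y := by
  have : Finite (setSubstructure (L := L) X) := hX.to_subtype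
  have hC : (Set.range g ∪ Y).Finite := (Set.finite_range g).union hY
  let C : L.Substructure S := setSubstructure (Set.range g ∪ Y)
  let i : setSubstructure (L := L) X ↪[L] setSubstructure (L := L) (insert s X) :=
    Substructure.inclusion fun _ hx => Set.mem_insert_of_mem s hx
  let j : setSubstructure (L := L) X ↪[L] C :=
    Embedding.codRestrict C g fun x => Or.inl (Set.mem_range_self x)
  have hnX : Nonempty (setSubstructure (L := L) X) := hne.to_subtype
  obtain ⟨D, f₁, g₁, hD, hcomm, hinter⟩ := hsap (.of (c := L.Structure) (setSubstructure (L := L) X))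
    (.of (c := L.Structure) (setSubstructure (L := L) (insert s X))) (.of (c := L.Structure) C) i j hnX
    (setSubstructure_mem_age hX) (setSubstructure_mem_age (hX.insert s))
    (setSubstructure_mem_age hC)
  obtain ⟨-, hDS⟩ := hD
  obtain ⟨h, hh⟩ := hS.extend_embedding (setSubstructure_mem_age hC).1 (h := hDS)
    (Substructure.subtype C) g₁
  refine ⟨h.comp f₁, fun x hx => ?_, fun hmem => ?_⟩
  · have h₁ : f₁ (i ⟨x, hx⟩) = g₁ (j ⟨x, hx⟩) := DFunLike.congr_fun hcomm (⟨x, hx⟩ : setSubstructure X)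
    have h₂ : (j ⟨x, hx⟩ : S) = h (g₁ (j ⟨x, hx⟩)) := DFunLike.congr_fun hh (j ⟨x, hx⟩)
    change h (f₁ (i ⟨x, hx⟩)) = _
    rw [h₁, ← h₂]
    rfl
  · let c : C := ⟨_, Or.inr hmem⟩
    have h₂ : h (f₁ ⟨s, Set.mem_insert s X⟩) = h (g₁ c) := DFunLike.congr_fun hh c
    obtain ⟨x, hx⟩ : f₁ ⟨s, Set.mem_insert s X⟩ ∈ Set.range (f₁.comp i) :=
      hinter ▸ ⟨⟨_, rfl⟩, ⟨c, (h.injective h₂).symm⟩⟩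
    have h₃ : i x = ⟨s, Set.mem_insert s X⟩ := f₁.injective hx
    have h₄ : (x : S) = s := congrArg Subtype.val h₃
    exact hs (h₄ ▸ x.2)

/-- The assignment `a i ↦ b i`, for `i ≤ n`, is a partial isomorphism. -/
structure IsPartialIso (L : FirstOrder.Language.{u, v}) {S : Type w} [L.Structure S]
    (a b : ℕ → S) (n : ℕ) : Prop where
  injOn : Set.InjOn b (Set.Iic n)
  relMap_iff : ∀ {r : ℕ} (R : L.Relations r) (v : Fin r → ℕ), (∀ j, v j ≤ n) →
    (Structure.RelMap R (b ∘ v) ↔ Structure.RelMap R (a ∘ v))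

theorem IsPartialIso.congr {a b b' : ℕ → S} {n : ℕ} (h : IsPartialIso L a b n)
    (hb : ∀ i ≤ n, b i = b' i) : IsPartialIso L a b' n where
  injOn := h.injOn.congr hb
  relMap_iff R v hv := by
    have : b' ∘ v = b ∘ v := funext fun j => (hb _ (hv j)).symm
    rw [this, h.relMap_iff R v hv]

theorem IsPartialIso.exists_update [L.IsRelational] (hS : L.IsUltrahomogeneous S)
    (hsap : StrongAmalgamation (L.age S)) (a : ℕ ≃ S) {b : ℕ → S} {n : ℕ}
    (h : IsPartialIso L a b n) {Y : Set S} (hY : Y.Finite) :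
    ∃ y ∉ Y, IsPartialIso L a (Function.update b (n + 1) y) (n + 1) := by
  have hle (x : setSubstructure (L := L) (a '' Set.Iic n)) : a.symm x ≤ n := by
    obtain ⟨_, i, hi, rfl⟩ := x
    simpa using hi
  let g : setSubstructure (L := L) (a '' Set.Iic n) ↪[L] S :=
    { toFun := fun x => b (a.symm x)
      inj' := fun x y hxy =>
        Subtype.ext (a.symm.injective (h.injOn (hle x) (hle y) hxy))
      map_fun' := fun f => isEmptyElim f
      map_rel' := fun R x => by
        refine (h.relMap_iff R (fun j => a.symm (x j)) fun j => hle (x j)).trans ?_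
        have : a ∘ (fun j => a.symm (x j)) = fun j => (x j : S) :=
          funext fun j => a.apply_symm_apply _
        rw [this]
        rfl }
  have hnot : a (n + 1) ∉ a '' Set.Iic n := by simp
  obtain ⟨g', hg', hgY⟩ := exists_extension_notMem hS hsap ((Set.finite_Iic n).image a)
    ⟨a 0, 0, Nat.zero_le n, rfl⟩ g hnot hY
  have hmem {i : ℕ} (hi : i ≤ n + 1) : a i ∈ insert (a (n + 1)) (a '' Set.Iic n) := by
    rcases Nat.le_succ_iff.1 hi with hi | rfl
    · exact Or.inr ⟨i, hi, rfl⟩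
    · exact Or.inl rfl
  have hval {i : ℕ} (hi : i ≤ n + 1) :
      Function.update b (n + 1) (g' ⟨a (n + 1), Set.mem_insert _ _⟩) i = g' ⟨a i, hmem hi⟩ := by
    rcases Nat.le_succ_iff.1 hi with hi' | rfl
    · rw [Function.update_of_ne (by omega), hg' (a i) ⟨i, hi', rfl⟩]
      exact congrArg b (a.symm_apply_apply i).symm
    · exact Function.update_self ..
  refine ⟨_, hgY, fun i hi j hj hij => ?_, fun R v hv => ?_⟩
  · rw [hval hi, hval hj] at hij
    exact a.injective (congrArg Subtype.val (g'.injective hij))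
  · have : Function.update b (n + 1) (g' ⟨a (n + 1), Set.mem_insert _ _⟩) ∘ v =
        g' ∘ fun j => ⟨a (v j), hmem (hv j)⟩ := funext fun j => hval (hv j)
    rw [this, g'.map_rel]
    rfl

/-- Under strong amalgamation, every enumeration of `S` can be copied along
points with strictly increasing values of a injective function `ρ`. -/
theorem exists_isPartialIso_strictMono [L.IsRelational] (hS : L.IsUltrahomogeneous S)
    (hsap : StrongAmalgamation (L.age S)) (a : ℕ ≃ S) (ρ : S → ℕ) (hρ : Function.Injective ρ) :
    ∃ b : ℕ → S, StrictMono (ρ ∘ b) ∧ ∀ n, IsPartialIso L a b n := by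
  have step (n : ℕ) (b : ℕ → S) : ∃ y, IsPartialIso L a b n →
      ρ (b n) < ρ y ∧ IsPartialIso L a (Function.update b (n + 1) y) (n + 1) := by
    by_cases h : IsPartialIso L a b n
    · obtain ⟨y, hy, hy'⟩ := h.exists_update hS hsap a
        ((Set.finite_Iic (ρ (b n))).preimage hρ.injOn)
      exact ⟨y, fun _ => ⟨not_le.1 hy, hy'⟩⟩
    · exact ⟨b n, fun h' => absurd h' h⟩
  choose y hy using step
  let s : ℕ → ℕ → S := fun n =>
    Nat.rec a (fun n b => Function.update b (n + 1) (y n b)) n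
  have s_succ (n : ℕ) : s (n + 1) = Function.update (s n) (n + 1) (y n (s n)) := rfl
  have s_iso (n : ℕ) : IsPartialIso L a (s n) n := by
    induction n with
    | zero => exact ⟨a.injective.injOn, fun _ _ _ => Iff.rfl⟩
    | succ n ih => exact (hy n (s n) ih).2
  have s_eq {i n : ℕ} (hin : i ≤ n) : s n i = s i i := by
    induction n, hin using Nat.le_induction with
    | base => rfl
    | succ n hn ih => rw [s_succ, Function.update_of_ne (by omega), ih]
  refine ⟨fun n => s n n, strictMono_nat_of_lt_succ fun n => ?_,
    fun n => (s_iso n).congr fun i hi => s_eq hi⟩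
  have : s (n + 1) (n + 1) = y n (s n) := by rw [s_succ, Function.update_self]
  simpa only [Function.comp_apply, this] using (hy n (s n) (s_iso n)).1

/-- Every copy of `S` inside `S` contains a copy of `S` for which the enumerations agree. -/
theorem exists_withLt_embedding_range_subset [L.IsRelational] [ltLang.Structure S]
    (hω : HasOrderTypeOmega S) (hS : L.IsUltrahomogeneous S)
    (hsap : StrongAmalgamation (L.age S)) (w : S ↪[L] S) :
    ∃ h : S ↪[withLt L] S, Set.range h ⊆ Set.range w := by
  obtain ⟨ρ⟩ := hω
  obtain ⟨b, hmono, hb⟩ := exists_isPartialIso_strictMono hS hsap ρ.toEquiv.symm (fun x => ρ (w x))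
    (ρ.injective.comp w.injective)
  refine ⟨⟨⟨fun x => w (b (ρ x)), fun x y hxy => ρ.injective (hmono.injective (congrArg ρ hxy))⟩,
    fun f => Sum.elim isEmptyElim Empty.elim f, fun {r} R x => ?_⟩, ?_⟩
  · rcases R with R | R
    · change Structure.RelMap R (w ∘ (b ∘ fun j => ρ (x j))) ↔ Structure.RelMap R x
      obtain ⟨N, hN⟩ := (Set.finite_range fun j => ρ (x j)).bddAbove
      rw [w.map_rel, (hb N).relMap_iff R _ fun j => hN (Set.mem_range_self j)]
      have : ρ.toEquiv.symm ∘ (fun j => ρ (x j)) = x :=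
        funext fun j => ρ.toEquiv.symm_apply_apply _
      rw [this]
    · cases R
      change Structure.RelMap ltSymb _ ↔ Structure.RelMap ltSymb x
      have key (z : Fin 2 → S) : Structure.RelMap ltSymb z ↔ ρ (z 0) < ρ (z 1) := by
        rw [ρ.map_rel_iff, ltOn]
        exact iff_of_eq (congrArg _ (List.ofFn_inj.1 rfl))
      rw [key, key]
      exact hmono.lt_iff_lt
  · rintro _ ⟨x, rfl⟩
    exact ⟨_, rfl⟩

/-- The `L`-reduct of an embedding of `withLt L`-structures defined on a substructure. -/
def reductEmbedding [L.IsRelational] [ltLang.Structure S] {A : (withLt L).Substructure S}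
    (f : A ↪[withLt L] S) : setSubstructure (L := L) (A : Set S) ↪[L] S where
  toFun x := f x
  inj' := f.injective
  map_fun' g := isEmptyElim g
  map_rel' R x := f.map_rel (Sum.inl R : (withLt L).Relations _) x

end LooseColorings

theorem mainTheorem4
    {L : FirstOrder.Language.{u, v}} [L.IsRelational]
    -- `S` with an `L`-structure and an interpretation of `<`, hence an `L ∪ {<}`-structure
    {S : Type w} [Countable S] [L.Structure S] [LooseColorings.ltLang.Structure S]
    (hω : LooseColorings.HasOrderTypeOmega S)
    -- the `L`-reduct of `S` is the Fraisse limit of `K`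
    {K : Set (CategoryTheory.Bundled.{w} L.Structure)}
    (hK : FirstOrder.Language.IsFraisse K) (hlim : FirstOrder.Language.IsFraisseLimit K S)
    -- with (finite) big Ramsey degrees, strong amalgamation and natural one-point extensions
    (hdeg : ∀ A : CategoryTheory.Bundled.{w} L.Structure, A ∈ K → Nonempty A →
      LooseColorings.bigRamseyDegree L A S < ⊤)
    (hsap : LooseColorings.StrongAmalgamation K)
    (hext : LooseColorings.HasNaturalOnePointExtensions L S)
    (A : LooseColorings.FinSub (LooseColorings.withLt L) S) :
    ∃ n : ℕ, ∀ (k : ℕ)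
      (γ : ∀ B : LooseColorings.FinSub (LooseColorings.withLt L) S,
        LooseColorings.copies B.carrier A.carrier → Fin k),
      ∃ S' : (LooseColorings.withLt L).Substructure S,
        Nonempty (FirstOrder.Language.Equiv (LooseColorings.withLt L) S' S) ∧
        ∃ (c : LooseColorings.copies S' A.carrier →
              LooseColorings.FinSub (LooseColorings.withLt L) S)
          (hc : ∀ E, E.1 ∈ LooseColorings.copies (c E).carrier A.carrier),
          (Set.range fun E : LooseColorings.copies S' A.carrier =>
            γ (c E) ⟨E.1, hc E⟩).encard ≤ n := by
  open LooseColorings FirstOrder FirstOrder.Language in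
  classical
  obtain rfl := hlim.age
  let A₀ : L.Substructure S := setSubstructure (A.carrier : Set S)
  have hA₀ : Nonempty A₀ := A.nonempty.to_subtype
  have hfin : bigRamseyDegree L A₀ S < ⊤ :=
    hdeg (.of (c := L.Structure) A₀) (setSubstructure_mem_age A.finite) hA₀
  simp only [bigRamseyDegree, iInf_lt_iff] at hfin
  obtain ⟨n, ⟨-, hn⟩, -⟩ := hfin
  refine ⟨n, fun k γ => ?_⟩
  have finSub (E : (withLt L).Substructure S) (hE : Nonempty (E ≃[withLt L] A.carrier)) :
      (E : Set S).Finite ∧ (E : Set S).Nonempty := by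
    obtain ⟨e⟩ := hE
    have := A.finite.to_subtype
    have := A.nonempty.to_subtype
    have : Finite E := Finite.of_equiv A.carrier e.symm.toEquiv
    exact ⟨(E : Set S).toFinite, Set.nonempty_coe_sort.1 (Nonempty.map e.symm ‹_›)⟩
  let fs (E : (withLt L).Substructure S) (hE : Nonempty (E ≃[withLt L] A.carrier)) :
      FinSub (withLt L) S := ⟨E, (finSub E hE).1, (finSub E hE).2⟩
  let col (E : (withLt L).Substructure S) (hE : Nonempty (E ≃[withLt L] A.carrier)) : Fin k :=
    γ (fs E hE) ⟨E, le_rfl, hE⟩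
  -- an embedding of the reduct of `A` gets the color of its image if it preserves the order
  let χ (f : A₀ ↪[L] S) : Fin (k + 2) :=
    if h : ∃ (E : (withLt L).Substructure S) (_ : Nonempty (E ≃[withLt L] A.carrier)),
      (E : Set S) = Set.range f then Fin.castAdd 2 (col h.choose h.choose_spec.choose) else 0
  have hχ (f : A₀ ↪[L] S) (E : (withLt L).Substructure S)
      (hE : Nonempty (E ≃[withLt L] A.carrier)) (hf : (E : Set S) = Set.range f) :
      χ f = Fin.castAdd 2 (col E hE) := by
    have h : ∃ (E : (withLt L).Substructure S) (_ : Nonempty (E ≃[withLt L] A.carrier)),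
      (E : Set S) = Set.range f := ⟨E, hE, hf⟩
    have hEq : h.choose = E := SetLike.coe_injective (h.choose_spec.choose_spec.trans hf.symm)
    have hcol : ∀ E' hE', E' = E → col E' hE' = col E hE := by
      rintro _ _ rfl
      rfl
    simp only [χ, dif_pos h, hcol _ _ hEq]
  obtain ⟨w, hw⟩ := hn (k + 2) (by omega) χ
  obtain ⟨h, hh⟩ := exists_withLt_embedding_range_subset hω hlim.ultrahomogeneous hsap w
  refine ⟨h.toHom.range, ⟨h.equivRange.symm⟩, fun E => fs E.1 E.2.2, fun E => ⟨le_rfl, E.2.2⟩, ?_⟩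
  refine le_trans ?_ hw
  rw [← (Fin.castAdd_injective k 2).encard_image]
  refine Set.encard_le_encard ?_
  rintro _ ⟨_, ⟨⟨E, hEh, hE⟩, rfl⟩, rfl⟩
  obtain ⟨e⟩ := id hE
  let f : A₀ ↪[L] S := reductEmbedding (E.subtype.comp e.symm.toEmbedding)
  have hfE : (E : Set S) = Set.range f := by
    ext x
    refine ⟨fun hx => ⟨e ⟨x, hx⟩, ?_⟩, ?_⟩
    · exact congrArg Subtype.val (e.symm_apply_apply ⟨x, hx⟩)
    · rintro ⟨y, rfl⟩
      exact (e.symm y).2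
  have hfw (x : A₀) : f x ∈ w.toHom.range := by
    have hx : f x ∈ (E : Set S) := hfE ▸ Set.mem_range_self x
    exact hh (hEh hx)
  let g : A₀ ↪[L] S := w.equivRange.symm.toEmbedding.comp (Embedding.codRestrict _ f hfw)
  have hg : w.comp g = f := by
    ext x
    exact congrArg Subtype.val (w.equivRange.apply_symm_apply ⟨f x, hfw x⟩)
  refine ⟨g, ?_⟩
  change χ (w.comp g) = _
  rw [hg, hχ f E hE hfE]
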